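/- Fix $d\ge 1$ and let $U_1,U_2,\ldots$ be independent random points, each uniformly distributed on the upper half-sphere $\mathbb S^d_+=\{x=(x_0,\ldots,x_d)\in\mathbb R^{d+1}: \|x\|=1,\ x_0\ge 0\}$. For $n\ge 0$ let $C_n=\{\alpha_1U_1+\cdots+\alpha_nU_n:\alpha_1,\ldots,\alpha_n\ge 0\}$ be the random convex cone generated by $U_1,\ldots,U_n$. For a polyhedral cone $C\subset\mathbb R^{d+1}$ let $f_j(C)$ be the number of $j$-dimensional faces of $C$, where a face is the intersection of $C$ with a supporting hyperplane, and for $k\in\{0,\ldots,d\}$ let $$h_{k+1}(C)=\tfrac12\,\mathbb P(C\cap L\ne\{0\})$$ be its $(k+1)$st Grassmann angle, where $L$ is a random $(d+1-k)$-dimensional linear subspace of $\mathbb R^{d+1}$ distributed according to the unique rotation invariant probability measure on the Grassmannian $G(d+1,d+1-k)$. Then for all $k\in\{1,\ldots,d\}$ and all integers $n\ge 0$ the random variables $h_{k+1}(C_n)$ and $f_{d+1-k}(C_{n+d+1-k})$ are integrable, and $$2\binom{n+d+1-k}{d+1-k}\Big(\frac12-\mathbb E\,h_{k+1}(C_n)\Big)=\mathbb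 E\, f_{d+1-k}(C_{n+d+1-k}).$$ -/

import Mathlib

open MeasureTheory ProbabilityTheory

noncomputable section

namespace RandomCones

/-- The Euclidean space `ℝ^N`. -/
abbrev E (N : ℕ) : Type := EuclideanSpace ℝ (Fin N)

/-! ### The uniform distribution on the half-sphere -/

/-- The `d`-dimensional upper half-sphere in `ℝ^{d+1}`. -/
def halfSphere (d : ℕ) : Set (E (d + 1)) :=
  {x | ‖x‖ = 1 ∧ 0 ≤ x 0}

/-- The uniform distribution on the upper half-sphere: the surface measure of the unit sphere of
`ℝ^{d+1}`, seen as a measure on `ℝ^{d+1}`, restricted to the half-sphere and normalized to total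
mass one. -/
def uniformHalfSphere (d : ℕ) : Measure (E (d + 1)) :=
  ((volume : Measure (E (d + 1))).toSphere.map Subtype.val)[|halfSphere d]

/-- The positive hull `{α₁ v₁ + … + αₙ vₙ : αᵢ ≥ 0}` of `v₁, …, vₙ`. -/
def posHull {N n : ℕ} (v : Fin n → E N) : Set (E N) :=
  (PointedCone.hull ℝ (Set.range v) : Set (E N))

/-- The random cone `Cₙ = pos {U₁, …, Uₙ}` (the points are indexed from `0` here). -/
def cone {Ω : Type*} {N : ℕ} (U : ℕ → Ω → E N) (n : ℕ) (ω : Ω) : Set (E N) :=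
  posHull fun i : Fin n => U i ω

/-! ### Faces -/

/-- `F` is a face of the closed convex set `P`: the intersection of `P` with a supporting
hyperplane `{x | ⟪a, x⟫ = c}`, i.e. one that touches `P` and has `P` on one of its sides. -/
def IsFace {N : ℕ} (P F : Set (E N)) : Prop :=
  ∃ (a : E N) (c : ℝ), a ≠ 0 ∧ (∀ x ∈ P, c ≤ inner ℝ a x) ∧ (∃ x ∈ P, inner ℝ a x = c) ∧
    F = {x ∈ P | inner ℝ a x = c}

/-- `f_k(P)`: the number of faces of `P` whose affine hull has dimension `k`. -/
def faceCount {N : ℕ} (k : ℕ) (P : Set (E N)) : ℕ :=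
  {F : Set (E N) | IsFace P F ∧ Module.finrank ℝ (vectorSpan ℝ F) = k}.ncard

/-! ### The Grassmannian and its invariant probability measure -/

/-- The orthogonal group `O(N)`, as a group of (continuous) linear maps of `ℝ^N`, with the topology
induced by the operator norm. -/
abbrev O (N : ℕ) : Type := unitary (E N →L[ℝ] E N)

instance instContinuousStarEnd (N : ℕ) : ContinuousStar (E N →L[ℝ] E N) :=
  ⟨(ContinuousLinearMap.adjoint (𝕜 := ℝ) (E := E N) (F := E N)).continuous⟩

instance instCompactSpaceO (N : ℕ) : CompactSpace (O N) := by
  refine isCompact_iff_compactSpace.mp ?_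
  refine Metric.isCompact_of_isClosed_isBounded isClosed_unitary ?_
  refine (Metric.isBounded_closedBall (x := (0 : E N →L[ℝ] E N)) (r := 1)).subset ?_
  intro u hu
  rw [mem_closedBall_zero_iff]
  refine ContinuousLinearMap.opNorm_le_bound _ zero_le_one fun x => ?_
  have h := (Unitary.linearIsometryEquiv (⟨u, hu⟩ : O N)).norm_map x
  rw [one_mul]
  exact le_of_eq h

/-- The Haar probability measure on `O(N)`. -/
def haarO (N : ℕ) : Measure (O N) :=
  Measure.haarMeasure ⊤

/-- The Grassmannian `G(N, m)` of all `m`-dimensional linear subspaces of `ℝ^N`. -/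
def Gr (N m : ℕ) : Type :=
  {L : Submodule ℝ (E N) // Module.finrank ℝ L = m}

/-- The linear subspace spanned by the first `m` standard basis vectors of `ℝ^N`. -/
def coordSubspace {N m : ℕ} (h : m ≤ N) : Submodule ℝ (E N) :=
  Submodule.span ℝ (Set.range fun i : Fin m => EuclideanSpace.basisFun (Fin N) ℝ (Fin.castLE h i))

theorem finrank_coordSubspace {N m : ℕ} (h : m ≤ N) :
    Module.finrank ℝ (coordSubspace h) = m := by
  have hli : LinearIndependent ℝ
      fun i : Fin m => EuclideanSpace.basisFun (Fin N) ℝ (Fin.castLE h i) :=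
    (EuclideanSpace.basisFun (Fin N) ℝ).orthonormal.linearIndependent.comp _
      (Fin.castLE_injective h)
  have h' := finrank_span_eq_card hli
  rw [Fintype.card_fin] at h'
  exact h'

/-- The orbit map `O(N) → G(N, m)`, `g ↦ g L₀`, where `L₀` is spanned by the first `m` standard
basis vectors. It is onto. -/
def orbitMap {N m : ℕ} (h : m ≤ N) (g : O N) : Gr N m :=
  ⟨(coordSubspace h).map (Unitary.linearIsometryEquiv g).toLinearEquiv.toLinearMap, by
    rw [LinearEquiv.finrank_map_eq, finrank_coordSubspace h]⟩

/-- The topology of the Grassmannian as a homogeneous space of `O(N)`: the finest one for which the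
orbit maps are continuous. -/
instance instTopologicalSpaceGr (N m : ℕ) : TopologicalSpace (Gr N m) :=
  ⨆ h : m ≤ N, TopologicalSpace.coinduced (orbitMap h) inferInstance

instance instMeasurableSpaceGr (N m : ℕ) : MeasurableSpace (Gr N m) :=
  borel _

instance instBorelSpaceGr (N m : ℕ) : BorelSpace (Gr N m) :=
  ⟨rfl⟩

/-- The rotation invariant probability measure `ν_m` on `G(N, m)`: the image of the Haar
probability measure of `O(N)` under the orbit map. -/
def grassmannHaar {N m : ℕ} (h : m ≤ N) : Measure (Gr N m) :=
  (haarO N).map (orbitMap h)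

/-- The `j`-th Grassmann angle `h_j(C)` of a cone `C` in `ℝ^N`, for `j ∈ {1, …, N}`: one half of
the probability that `C` meets nontrivially a random linear subspace of codimension `j - 1` with
distribution `ν_{N-(j-1)}`. -/
def grassmannAngle {N : ℕ} (j : ℕ) (C : Set (E N)) : ℝ :=
  1 / 2 * (grassmannHaar (Nat.sub_le N (j - 1))).real {L | C ∩ (L.1 : Set (E N)) ≠ {0}}

end RandomCones

end

/-! Put `m = d + 1 - k`. Both sides reduce to `meetProb d n m`, the probability that the positive
hull of `n` of the points meets the span of `m` further ones nontrivially.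

Angles: the uniform law on the sphere is rotation invariant, folding onto the half-sphere changes
vectors only by signs and so keeps spans, and `O(d+1)` acts transitively on `m`-dimensional
subspaces. Hence the span of `m` independent points has the law of the random subspace `L`
(`haarO_rotate_frame_eq`), and the expected angle is half of `meetProb d n m`.

Faces: almost surely the points are in general position, and then the `m`-faces of the cone over `n
+ m` points correspond to the `m`-element sets of generators cut out by a supporting hyperplane
(`faceCount_posHull`). By Hahn–Banach a set is cut out exactly when its span misses the convex hull
of the other `n` points (`exists_inner_pos_iff_notMem_meetSet`). Each of the `(n + m).choose m` sets
thus contributes `1 - meetProb d n m`.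

The half-sphere links the two: all points have positive zeroth coordinate almost surely, so no
convex combination vanishes, and meeting `L` nontrivially means that the convex hull meets `L`
(`posHull_inter_ne_iff`). -/

noncomputable section

namespace RandomCones

open scoped Pointwise ENNReal

/-! ### Random vectors in general position -/

/-- If `ν` vanishes on proper subspaces, then at most `N` independent `ν`-distributed vectors are
almost surely linearly independent. -/
theorem ae_linearIndependent_pi {N : ℕ} (ν : Measure (E N)) [IsProbabilityMeasure ν]
    (hν : ∀ S : Submodule ℝ (E N), S ≠ ⊤ → ν S = 0) {m : ℕ} (hm : m ≤ N) :
    ∀ᵐ w ∂(Measure.pi fun _ : Fin m => ν), LinearIndependent ℝ w := by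
  induction m with
  | zero => exact .of_forall fun w => linearIndependent_empty_type
  | succ m ih =>
    have hmp := measurePreserving_piFinSuccAbove (fun _ : Fin (m + 1) => ν) 0
    have hclosed : IsClosed {p : (Fin m → E N) × E N |
        ¬ LinearIndependent ℝ (Fin.cons p.2 p.1 : Fin (m + 1) → E N)} := by
      have : Continuous fun p : (Fin m → E N) × E N =>
          (Fin.cons p.2 p.1 : Fin (m + 1) → E N) := by
        refine continuous_pi fun i => ?_
        refine Fin.cases ?_ (fun j => ?_) i
        · simpa using continuous_snd
        · simp only [Fin.cons_succ]
          fun_prop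
      exact (isOpen_setOfPred_linearIndependent.preimage this).isClosed_compl
    have hprod : ((Measure.pi fun _ : Fin m => ν).prod ν) {p : (Fin m → E N) × E N |
        ¬ LinearIndependent ℝ (Fin.cons p.2 p.1 : Fin (m + 1) → E N)} = 0 := by
      rw [Measure.measure_prod_null hclosed.measurableSet]
      filter_upwards [ih (by omega)] with w hw
      -- With the other `m < N` vectors fixed, the new one must avoid their span, a proper subspace
      -- and hence a null set.
      have hne : Submodule.span ℝ (Set.range w) ≠ ⊤ := by
        intro h
        have h1 := finrank_span_eq_card hw
        rw [h, finrank_top, finrank_euclideanSpace_fin, Fintype.card_fin] at h1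
        omega
      refine measure_mono_null ?_ (hν _ hne)
      intro x hx
      by_contra hx'
      exact hx (linearIndependent_finCons.2 ⟨hw, hx'⟩)
    have hswap : ∀ᵐ p ∂(ν.prod (Measure.pi fun _ : Fin m => ν)),
        LinearIndependent ℝ (Fin.cons p.1 p.2 : Fin (m + 1) → E N) := by
      have := (Measure.measurePreserving_swap (μ := ν)
        (ν := Measure.pi fun _ : Fin m => ν)).quasiMeasurePreserving.ae
        (p := fun p => LinearIndependent ℝ (Fin.cons p.2 p.1 : Fin (m + 1) → E N)) hprod
      exact this
    have := hmp.quasiMeasurePreserving.ae hswap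
    filter_upwards [this] with w hw
    convert hw using 1
    exact (Fin.cons_self_tail w).symm

/-! ### The invariant measure on the sphere -/

/-- The surface measure of the unit sphere, seen as a measure on `ℝ^N`. -/
def sphereMeasure (N : ℕ) : Measure (E N) :=
  (volume : Measure (E N)).toSphere.map Subtype.val

instance (N : ℕ) : IsFiniteMeasure (sphereMeasure N) := by
  unfold sphereMeasure; infer_instance

theorem sphereMeasure_apply {N : ℕ} {s : Set (E N)} (hs : MeasurableSet s) :
    sphereMeasure N s = N * volume (Set.Ioo (0 : ℝ) 1 • (Metric.sphere 0 1 ∩ s)) := by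
  rw [sphereMeasure, Measure.map_apply measurable_subtype_coe hs,
    Measure.toSphere_apply' _ (measurable_subtype_coe hs), Subtype.image_preimage_coe,
    finrank_euclideanSpace_fin]

theorem sphereMeasure_univ_ne_zero (d : ℕ) : sphereMeasure (d + 1) Set.univ ≠ 0 := by
  rw [sphereMeasure, Measure.map_apply measurable_subtype_coe .univ, Set.preimage_univ]
  simp [(Metric.measure_ball_pos volume (0 : E (d + 1)) one_pos).ne']

theorem ae_norm_eq_one_sphereMeasure (N : ℕ) : ∀ᵐ x ∂sphereMeasure N, ‖x‖ = 1 := by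
  refine (ae_map_iff measurable_subtype_coe.aemeasurable
    (measurableSet_eq_fun measurable_norm measurable_const)).2 (.of_forall fun x => ?_)
  simp

/-- Surface measure is, up to a constant, the volume of the truncated cone over a set; a linear
isometry commutes with forming that cone and preserves volume. -/
theorem measurePreserving_sphereMeasure {N : ℕ} (g : E N ≃ₗᵢ[ℝ] E N) :
    MeasurePreserving g (sphereMeasure N) (sphereMeasure N) := by
  refine ⟨g.continuous.measurable, Measure.ext fun s hs => ?_⟩
  rw [Measure.map_apply g.continuous.measurable hs,
    sphereMeasure_apply (g.continuous.measurable hs), sphereMeasure_apply hs]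
  congr 1
  rw [← g.measurePreserving.measure_preimage_emb g.toHomeomorph.measurableEmbedding
    (Set.Ioo (0 : ℝ) 1 • (Metric.sphere 0 1 ∩ s))]
  congr 1
  ext x
  simp only [Set.mem_smul, Set.mem_inter_iff, Set.mem_preimage, mem_sphere_zero_iff_norm]
  constructor
  · rintro ⟨t, ht, y, ⟨hy, hys⟩, rfl⟩
    exact ⟨t, ht, g y, ⟨by simpa using hy, hys⟩, by simp⟩
  · rintro ⟨t, ht, y, ⟨hy, hys⟩, h⟩
    refine ⟨t, ht, g.symm y, ⟨by simpa using hy, by simpa using hys⟩, ?_⟩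
    rw [← map_smul, h, g.symm_apply_apply]

theorem sphereMeasure_submodule {N : ℕ} (S : Submodule ℝ (E N)) (hS : S ≠ ⊤) :
    sphereMeasure N S = 0 := by
  rw [sphereMeasure_apply S.closed_of_finiteDimensional.measurableSet]
  refine mul_eq_zero_of_right _ (measure_mono_null ?_ (Measure.addHaar_submodule volume S hS))
  rintro _ ⟨t, -, y, ⟨-, hy⟩, rfl⟩
  exact S.smul_mem t hy

/-- The uniform distribution on the unit sphere. -/
def sphereUniform (N : ℕ) : Measure (E N) :=
  (sphereMeasure N Set.univ)⁻¹ • sphereMeasure N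

instance (d : ℕ) : IsProbabilityMeasure (sphereUniform (d + 1)) :=
  ⟨by simp [sphereUniform, ENNReal.inv_mul_cancel (sphereMeasure_univ_ne_zero d)
    (measure_ne_top _ _)]⟩

theorem measurePreserving_sphereUniform {N : ℕ} (g : E N ≃ₗᵢ[ℝ] E N) :
    MeasurePreserving g (sphereUniform N) (sphereUniform N) :=
  (measurePreserving_sphereMeasure g).smul_measure _

theorem sphereUniform_submodule {N : ℕ} (S : Submodule ℝ (E N)) (hS : S ≠ ⊤) :
    sphereUniform N S = 0 := by
  simp [sphereUniform, sphereMeasure_submodule S hS]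

/-! ### Folding the sphere onto the half-sphere -/

/-- The map that reflects the lower half-space to the upper one through the origin. -/
def fold {d : ℕ} (x : E (d + 1)) : E (d + 1) :=
  if 0 ≤ x 0 then x else -x

theorem measurable_coord {d : ℕ} : Measurable fun x : E (d + 1) => x 0 := by
  fun_prop

theorem measurable_fold (d : ℕ) : Measurable (fold (d := d)) :=
  Measurable.ite (measurableSet_le measurable_const measurable_coord) measurable_id measurable_neg

/-- The hyperplane `x₀ = 0`. -/
def equator (d : ℕ) : Submodule ℝ (E (d + 1)) :=
  LinearMap.ker (EuclideanSpace.proj (𝕜 := ℝ) (0 : Fin (d + 1))).toLinearMap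

theorem mem_equator {d : ℕ} {x : E (d + 1)} : x ∈ equator d ↔ x 0 = 0 := by
  simp [equator]

theorem equator_ne_top (d : ℕ) : equator d ≠ ⊤ := by
  intro h
  have : EuclideanSpace.single (0 : Fin (d + 1)) (1 : ℝ) ∈ equator d := h ▸ Submodule.mem_top
  simp [mem_equator] at this

theorem measurableSet_halfSphere (d : ℕ) : MeasurableSet (halfSphere d) :=
  (measurableSet_eq_fun measurable_norm measurable_const).inter
    (measurableSet_le measurable_const measurable_coord)

theorem sphereMeasure_preimage_fold {d : ℕ} {s : Set (E (d + 1))} (hs : MeasurableSet s) :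
    sphereMeasure (d + 1) (fold ⁻¹' s) = 2 * sphereMeasure (d + 1) (halfSphere d ∩ s) := by
  have hP : MeasurableSet {x : E (d + 1) | 0 ≤ x 0} :=
    measurableSet_le measurable_const measurable_coord
  have hnull : ∀ᵐ x ∂sphereMeasure (d + 1), x 0 ≠ 0 := by
    have := sphereMeasure_submodule (equator d) (equator_ne_top d)
    filter_upwards [measure_eq_zero_iff_ae_notMem.1 this] with x hx h
    exact hx (mem_equator.2 h)
  have h1 : sphereMeasure (d + 1) (fold ⁻¹' s ∩ {x | 0 ≤ x 0}) =
      sphereMeasure (d + 1) (halfSphere d ∩ s) := by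
    refine measure_congr ?_
    filter_upwards [ae_norm_eq_one_sphereMeasure (d + 1)] with x hx
    apply propext
    change (fold x ∈ s ∧ 0 ≤ x 0) ↔ ((‖x‖ = 1 ∧ 0 ≤ x 0) ∧ x ∈ s)
    constructor
    · rintro ⟨h, h0⟩
      exact ⟨⟨hx, h0⟩, by simpa [fold, h0] using h⟩
    · rintro ⟨⟨-, h0⟩, h⟩
      exact ⟨by simpa [fold, h0] using h, h0⟩
  have h2 : sphereMeasure (d + 1) (fold ⁻¹' s \ {x | 0 ≤ x 0}) =
      sphereMeasure (d + 1) (halfSphere d ∩ s) := by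
    -- The antipodal map carries the open lower half onto the upper half; the two descriptions
    -- differ only on the null equator.
    rw [← (measurePreserving_sphereMeasure (LinearIsometryEquiv.neg ℝ)).measure_preimage
      ((measurableSet_halfSphere d).inter hs).nullMeasurableSet]
    refine measure_congr ?_
    filter_upwards [ae_norm_eq_one_sphereMeasure (d + 1), hnull] with x hx hx0
    apply propext
    change (fold x ∈ s ∧ ¬ 0 ≤ x 0) ↔ ((‖-x‖ = 1 ∧ 0 ≤ (-x) 0) ∧ -x ∈ s)
    rw [norm_neg, PiLp.neg_apply, neg_nonneg]
    constructor
    · rintro ⟨h, h0⟩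
      exact ⟨⟨hx, by linarith⟩, by simpa [fold, h0] using h⟩
    · rintro ⟨⟨-, h0⟩, h⟩
      have h0' : ¬ 0 ≤ x 0 := fun h' => hx0 (le_antisymm h0 h')
      exact ⟨by simpa [fold, h0'] using h, h0'⟩
  rw [← measure_inter_add_sdiff _ hP, h1, h2, two_mul]

theorem uniformHalfSphere_eq_map_fold (d : ℕ) :
    uniformHalfSphere d = (sphereUniform (d + 1)).map fold := by
  refine Measure.ext fun s hs => ?_
  have huniv := sphereMeasure_preimage_fold (d := d) MeasurableSet.univ
  rw [Set.preimage_univ, Set.inter_univ] at huniv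
  have hfold := sphereMeasure_preimage_fold hs
  change (sphereMeasure (d + 1))[|halfSphere d] s = _
  rw [cond_apply (measurableSet_halfSphere d), Measure.map_apply (measurable_fold d) hs,
    sphereUniform, Measure.smul_apply, hfold, huniv, smul_eq_mul,
    ENNReal.mul_inv (.inl two_ne_zero) (.inl ENNReal.ofNat_ne_top)]
  rw [mul_mul_mul_comm, ENNReal.inv_mul_cancel two_ne_zero ENNReal.ofNat_ne_top, one_mul]

instance (d : ℕ) : IsProbabilityMeasure (uniformHalfSphere d) := by
  rw [uniformHalfSphere_eq_map_fold]
  exact Measure.isProbabilityMeasure_map (measurable_fold d).aemeasurable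

theorem uniformHalfSphere_submodule {d : ℕ} (S : Submodule ℝ (E (d + 1))) (hS : S ≠ ⊤) :
    uniformHalfSphere d S = 0 := by
  rw [uniformHalfSphere_eq_map_fold, Measure.map_apply (measurable_fold d)
    S.closed_of_finiteDimensional.measurableSet]
  refine measure_mono_null (fun x hx => ?_) (sphereUniform_submodule S hS)
  have hx : fold x ∈ S := hx
  unfold fold at hx
  split_ifs at hx
  · exact hx
  · simpa using hx

theorem ae_pos_uniformHalfSphere (d : ℕ) : ∀ᵐ x ∂uniformHalfSphere d, 0 < x 0 := by
  have h := uniformHalfSphere_submodule (equator d) (equator_ne_top d)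
  have h' : ∀ᵐ x ∂uniformHalfSphere d, x ∈ halfSphere d :=
    ae_cond_mem (measurableSet_halfSphere d)
  filter_upwards [measure_eq_zero_iff_ae_notMem.1 h, h'] with x hx hx'
  exact lt_of_le_of_ne hx'.2 fun h0 => hx (mem_equator.2 h0.symm)

/-! ### The invariant distribution of random subspaces -/

instance (N : ℕ) : (haarO N).IsHaarMeasure := by
  unfold haarO; infer_instance

instance (N : ℕ) : IsProbabilityMeasure (haarO N) :=
  ⟨by
    have h := Measure.haarMeasure_self (K₀ := (⊤ : TopologicalSpace.PositiveCompacts (O N)))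
    rwa [TopologicalSpace.PositiveCompacts.coe_top] at h⟩

/-- The image of Haar measure under a right translation is again a Haar probability measure, so
uniqueness applies. -/
theorem measurePreserving_mul_right_haarO {N : ℕ} (h : O N) :
    MeasurePreserving (fun g : O N => g * h) (haarO N) (haarO N) := by
  have hm : Measurable fun g : O N => g * h := (continuous_mul_const h).measurable
  refine ⟨hm, ?_⟩
  have := Measure.isProbabilityMeasure_map (μ := haarO N) hm.aemeasurable
  exact Measure.isHaarMeasure_eq_of_isProbabilityMeasure _ _

/-- The first `m` vectors of the standard basis. -/
def frame {N m : ℕ} (h : m ≤ N) (i : Fin m) : E N :=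
  EuclideanSpace.basisFun (Fin N) ℝ (Fin.castLE h i)

/-- The action of `O(N)` on families of vectors. -/
def rotate {N m : ℕ} (g : O N) (w : Fin m → E N) (i : Fin m) : E N :=
  (g : E N →L[ℝ] E N) (w i)

theorem coe_linearIsometryEquiv {N : ℕ} (g : O N) (x : E N) :
    Unitary.linearIsometryEquiv g x = (g : E N →L[ℝ] E N) x := rfl

theorem rotate_mul {N m : ℕ} (g h : O N) (w : Fin m → E N) :
    rotate (g * h) w = rotate g (rotate h w) := rfl

theorem continuous_rotate (N m : ℕ) :
    Continuous fun p : O N × (Fin m → E N) => rotate p.1 p.2 := by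
  refine continuous_pi fun i => ?_
  exact (continuous_subtype_val.comp continuous_fst).clm_apply
    ((continuous_apply i).comp continuous_snd)

theorem span_rotate {N m : ℕ} (g : O N) (w : Fin m → E N) :
    Submodule.span ℝ (Set.range (rotate g w)) = (Submodule.span ℝ (Set.range w)).map
      (Unitary.linearIsometryEquiv g).toLinearEquiv.toLinearMap := by
  rw [Submodule.map_span, ← Set.range_comp]
  rfl

theorem linearIndependent_rotate {N m : ℕ} (g : O N) {w : Fin m → E N}
    (hw : LinearIndependent ℝ w) : LinearIndependent ℝ (rotate g w) :=
  hw.map' (Unitary.linearIsometryEquiv g).toLinearEquiv.toLinearMap (LinearEquiv.ker _)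

theorem linearIndependent_frame {N m : ℕ} (h : m ≤ N) : LinearIndependent ℝ (frame h) :=
  (EuclideanSpace.basisFun (Fin N) ℝ).orthonormal.linearIndependent.comp _
    (Fin.castLE_injective h)

theorem span_rotate_frame {N m : ℕ} (h : m ≤ N) (g : O N) :
    Submodule.span ℝ (Set.range (rotate g (frame h))) = (orbitMap h g).1 :=
  span_rotate g _

/-- `O(N)` acts transitively on the `m`-dimensional subspaces. -/
theorem exists_span_rotate_frame_eq {N m : ℕ} (h : m ≤ N) {w : Fin m → E N}
    (hw : LinearIndependent ℝ w) :
    ∃ g : O N, Submodule.span ℝ (Set.range (rotate g (frame h))) =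
      Submodule.span ℝ (Set.range w) := by
  set S := Submodule.span ℝ (Set.range w) with hS
  have hfin : Module.finrank ℝ S = m := by
    rw [hS, finrank_span_eq_card hw, Fintype.card_fin]
  let b : OrthonormalBasis (Fin m) ℝ S := (stdOrthonormalBasis ℝ S).reindex (finCongr hfin)
  let v : Fin N → E N := fun i => if hi : (i : ℕ) < m then (b ⟨i, hi⟩ : E N) else 0
  have hv : ∀ i : Fin m, v (Fin.castLE h i) = b i := fun i => by simp [v]
  have hon : Orthonormal ℝ ((Set.range (Fin.castLE h)).domRestrict v) := by
    have hb : Orthonormal ℝ fun i => (b i : E N) :=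
      b.orthonormal.comp_linearIsometry S.subtypeₗᵢ
    let e := Equiv.ofInjective _ (Fin.castLE_injective h)
    have := hb.comp e.symm e.symm.injective
    convert this using 1
    funext x
    obtain ⟨i, rfl⟩ := e.surjective x
    simp only [Function.comp_apply, Equiv.symm_apply_apply]
    exact hv i
  obtain ⟨b', hb'⟩ := hon.exists_orthonormalBasis_extension_of_card_eq (by simp)
  let L : E N ≃ₗᵢ[ℝ] E N := (EuclideanSpace.basisFun (Fin N) ℝ).equiv b' (Equiv.refl _)
  refine ⟨Unitary.linearIsometryEquiv.symm L, ?_⟩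
  have hrot : rotate (Unitary.linearIsometryEquiv.symm L) (frame h) = fun i => (b i : E N) := by
    funext i
    have h1 : rotate (Unitary.linearIsometryEquiv.symm L) (frame h) i = L (frame h i) := by
      rw [rotate, ← coe_linearIsometryEquiv, MulEquiv.apply_symm_apply]
    rw [h1, frame, OrthonormalBasis.equiv_apply_basis, Equiv.refl_apply,
      hb' _ (Set.mem_range_self i), hv]
  rw [hrot]
  have hspan := congrArg (Submodule.map S.subtype) b.toBasis.span_eq
  rw [Submodule.map_span, ← Set.range_comp, Submodule.map_subtype_top] at hspan
  convert hspan using 3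
  funext i
  simp

theorem span_range_fold {d m : ℕ} (w : Fin m → E (d + 1)) :
    Submodule.span ℝ (Set.range fun i => fold (w i)) = Submodule.span ℝ (Set.range w) := by
  have key : ∀ x : E (d + 1), fold x = x ∨ fold x = -x := fun x => by
    unfold fold; split_ifs <;> simp
  apply le_antisymm <;> rw [Submodule.span_le] <;> rintro _ ⟨i, rfl⟩
  · have hi : w i ∈ Submodule.span ℝ (Set.range w) := Submodule.subset_span ⟨i, rfl⟩
    rcases key (w i) with h | h
    · simpa [h] using hi
    · simpa [h] using hi
  · have hi : fold (w i) ∈ Submodule.span ℝ (Set.range fun i => fold (w i)) :=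
      Submodule.subset_span ⟨i, rfl⟩
    rcases key (w i) with h | h
    · rwa [h] at hi
    · rw [h] at hi
      simpa using hi

theorem map_rotate_pi_sphereUniform {d m : ℕ} (g : O (d + 1)) :
    MeasurePreserving (rotate g) (Measure.pi fun _ : Fin m => sphereUniform (d + 1))
      (Measure.pi fun _ : Fin m => sphereUniform (d + 1)) :=
  measurePreserving_pi _ _ fun _ =>
    measurePreserving_sphereUniform (Unitary.linearIsometryEquiv g)

/-- The span of `m` independent uniform points of the half-sphere has the rotation invariant
distribution: an event that depends on the span only has the same probability for such points and
for a Haar distributed rotation of the standard frame. -/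
theorem haarO_rotate_frame_eq {d m : ℕ} (h : m ≤ d + 1) {A : Set (Fin m → E (d + 1))}
    (hA : MeasurableSet A)
    (hspan : ∀ w w', LinearIndependent ℝ w → LinearIndependent ℝ w' →
      Submodule.span ℝ (Set.range w) = Submodule.span ℝ (Set.range w') → (w ∈ A ↔ w' ∈ A)) :
    haarO (d + 1) {g | rotate g (frame h) ∈ A} =
      (Measure.pi fun _ : Fin m => uniformHalfSphere d) A := by
  set ν := Measure.pi fun _ : Fin m => sphereUniform (d + 1) with hν
  have hLI : ∀ᵐ w ∂ν, LinearIndependent ℝ w :=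
    ae_linearIndependent_pi _ sphereUniform_submodule h
  have hfold : (Measure.pi fun _ : Fin m => uniformHalfSphere d) A = ν A := by
    have h1 := Measure.pi_map_pi (μ := fun _ : Fin m => sphereUniform (d + 1))
      (f := fun _ => fold) (hμ := fun _ => by
        rw [← uniformHalfSphere_eq_map_fold]; infer_instance)
      fun _ => (measurable_fold d).aemeasurable
    simp only [← uniformHalfSphere_eq_map_fold] at h1
    have hm : Measurable fun (w : Fin m → E (d + 1)) i => fold (w i) :=
      measurable_pi_lambda _ fun i => (measurable_fold d).comp (measurable_pi_apply i)
    rw [← h1, Measure.map_apply hm hA]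
    refine measure_congr ?_
    filter_upwards [hLI] with w hw
    refine propext (hspan _ _ ?_ hw (span_range_fold w))
    rw [linearIndependent_iff_card_eq_finrank_span] at hw ⊢
    rw [hw, Set.finrank, Set.finrank, span_range_fold]
  have hjoint : MeasurableSet {p : O (d + 1) × (Fin m → E (d + 1)) | rotate p.1 p.2 ∈ A} :=
    (continuous_rotate _ _).measurable hA
  -- Average over a random rotation of random vectors. With the rotation fixed, invariance of `ν`
  -- gives `ν A`; with the vectors fixed, transitivity and right invariance of Haar measure give the
  -- probability for the frame.
  have hfub : ∫⁻ g, ν {w | rotate g w ∈ A} ∂haarO (d + 1) =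
      ∫⁻ w, haarO (d + 1) {g | rotate g w ∈ A} ∂ν :=
    (Measure.prod_apply hjoint).symm.trans (Measure.prod_apply_symm hjoint)
  have hleft : ∀ g : O (d + 1), ν {w | rotate g w ∈ A} = ν A := fun g =>
    (map_rotate_pi_sphereUniform g).measure_preimage hA.nullMeasurableSet
  have hright : ∀ᵐ w ∂ν, haarO (d + 1) {g | rotate g w ∈ A} =
      haarO (d + 1) {g | rotate g (frame h) ∈ A} := by
    filter_upwards [hLI] with w hw
    obtain ⟨k, hk⟩ := exists_span_rotate_frame_eq h hw
    have hmeas : MeasurableSet {g : O (d + 1) | rotate g (frame h) ∈ A} :=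
      ((continuous_rotate _ _).comp (Continuous.prodMk_left (frame h))).measurable hA
    rw [← (measurePreserving_mul_right_haarO k).measure_preimage hmeas.nullMeasurableSet]
    congr 1
    ext g
    refine hspan _ _ (linearIndependent_rotate g hw)
      (linearIndependent_rotate _ (linearIndependent_frame h)) ?_
    rw [rotate_mul, span_rotate, span_rotate g (rotate k _), hk]
  rw [hfold]
  have h2 := hfub
  rw [lintegral_congr_ae hright] at h2
  simp only [hleft, lintegral_const, measure_univ, mul_one] at h2
  exact h2.symm

/-! ### Cones meeting subspaces -/

/-- The pairs of families `(v, w)` such that some convex combination of `v` lies in the span of `w`,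
or `w` is linearly dependent (and `v` is nonempty). -/
def meetSet (N n m : ℕ) : Set ((Fin n → E N) × (Fin m → E N)) :=
  {p | ∃ α ∈ stdSimplex ℝ (Fin n),
    ¬ LinearIndependent ℝ (Fin.cons (∑ i, α i • p.1 i) p.2 : Fin (m + 1) → E N)}

theorem mem_meetSet {N n m : ℕ} {v : Fin n → E N} {w : Fin m → E N}
    (hw : LinearIndependent ℝ w) :
    (v, w) ∈ meetSet N n m ↔
      ∃ α ∈ stdSimplex ℝ (Fin n), ∑ i, α i • v i ∈ Submodule.span ℝ (Set.range w) := by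
  simp [meetSet, linearIndependent_finCons, hw]

/-- Linear dependence is a closed condition and the simplex is compact, so projecting the simplex
away preserves closedness. Admitting dependent `w` in `meetSet` is what makes this work, and all
measurability rests on it. -/
theorem isClosed_meetSet (N n m : ℕ) : IsClosed (meetSet N n m) := by
  have hcont : Continuous fun q : stdSimplex ℝ (Fin n) × ((Fin n → E N) × (Fin m → E N)) =>
      (Fin.cons (∑ i, q.1.1 i • q.2.1 i) q.2.2 : Fin (m + 1) → E N) := by
    refine continuous_pi fun i => ?_
    refine Fin.cases ?_ (fun j => ?_) i
    · simp only [Fin.cons_zero]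
      refine continuous_finsetSum _ fun i _ => ?_
      exact ((continuous_apply i).comp (continuous_subtype_val.comp continuous_fst)).smul
        ((continuous_apply i).comp (continuous_fst.comp continuous_snd))
    · simp only [Fin.cons_succ]
      fun_prop
  have hcl := ((isOpen_setOfPred_linearIndependent (𝕜 := ℝ)).preimage hcont).isClosed_compl
  convert isClosedMap_snd_of_compactSpace _ hcl using 1
  ext p
  constructor
  · rintro ⟨α, hα, h⟩
    exact ⟨(⟨α, hα⟩, p), h, rfl⟩
  · rintro ⟨⟨α, p⟩, h, rfl⟩
    exact ⟨α.1, α.2, h⟩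

theorem mem_posHull {N n : ℕ} {v : Fin n → E N} {x : E N} :
    x ∈ posHull v ↔ ∃ c : Fin n → ℝ, (∀ i, 0 ≤ c i) ∧ ∑ i, c i • v i = x := by
  unfold posHull PointedCone.hull
  rw [SetLike.mem_coe, Submodule.mem_span_range_iff_exists_fun]
  constructor
  · rintro ⟨c, h⟩
    exact ⟨fun i => (c i : ℝ), fun i => (c i).2, h⟩
  · rintro ⟨c, hc, h⟩
    exact ⟨fun i => ⟨c i, hc i⟩, h⟩

theorem posHull_inter_ne_iff {d n : ℕ} {v : Fin n → E (d + 1)} (hv : ∀ i, 0 < v i 0)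
    (L : Submodule ℝ (E (d + 1))) :
    posHull v ∩ L ≠ {0} ↔ ∃ α ∈ stdSimplex ℝ (Fin n), ∑ i, α i • v i ∈ L := by
  constructor
  · intro h
    have h0 : (0 : E (d + 1)) ∈ posHull v ∩ L :=
      ⟨mem_posHull.2 ⟨0, fun _ => le_rfl, by simp⟩, L.zero_mem⟩
    obtain ⟨x, ⟨hx, hxL⟩, hx0⟩ : ∃ x ∈ posHull v ∩ L, x ≠ 0 := by
      by_contra! hall
      exact h (Set.eq_singleton_iff_unique_mem.2 ⟨h0, hall⟩)
    obtain ⟨c, hc, rfl⟩ := mem_posHull.1 hx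
    have hpos : 0 < ∑ i, c i := by
      refine lt_of_le_of_ne (Finset.sum_nonneg fun i _ => hc i) fun hsum => hx0 ?_
      have := (Finset.sum_eq_zero_iff_of_nonneg fun i _ => hc i).1 hsum.symm
      exact Finset.sum_eq_zero fun i hi => by rw [this i hi, zero_smul]
    refine ⟨fun i => (∑ i, c i)⁻¹ * c i,
      ⟨fun i => mul_nonneg (inv_nonneg.2 hpos.le) (hc i), ?_⟩, ?_⟩
    · rw [← Finset.mul_sum, inv_mul_cancel₀ hpos.ne']
    · simp only [mul_smul, ← Finset.smul_sum]
      exact L.smul_mem _ hxL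
  · rintro ⟨α, ⟨hα0, hα1⟩, hL⟩ h
    have hx : ∑ i, α i • v i ∈ posHull v ∩ L := ⟨mem_posHull.2 ⟨α, hα0, rfl⟩, hL⟩
    rw [h, Set.mem_singleton_iff] at hx
    have hx0 : ∑ i, α i * v i 0 = 0 := by
      have := congrArg (fun y : E (d + 1) => y 0) hx
      simpa using this
    have hz := (Finset.sum_eq_zero_iff_of_nonneg
      fun i _ => mul_nonneg (hα0 i) (hv i).le).1 hx0
    have : ∑ i, α i = 0 := Finset.sum_eq_zero fun i hi =>
      (mul_eq_zero.1 (hz i hi)).resolve_right (hv i).ne'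
    rw [this] at hα1
    exact zero_ne_one hα1

/-- A subspace avoids the convex hull of `v` if and only if it lies in a hyperplane with `v` strictly
on one of its sides. -/
theorem exists_inner_pos_iff_notMem_meetSet {N n m : ℕ} (hm : m < N) {v : Fin n → E N}
    {w : Fin m → E N} (hw : LinearIndependent ℝ w) :
    (∃ a : E N, a ≠ 0 ∧ (∀ i, inner ℝ a (w i) = 0) ∧ ∀ j, 0 < inner ℝ a (v j)) ↔
      (v, w) ∉ meetSet N n m := by
  rw [mem_meetSet hw]
  constructor
  · rintro ⟨a, -, haw, hav⟩ ⟨α, ⟨hα0, hα1⟩, hmem⟩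
    have hle : Submodule.span ℝ (Set.range w) ≤ LinearMap.ker (innerₛₗ ℝ a) := by
      rw [Submodule.span_le]
      rintro _ ⟨i, rfl⟩
      exact haw i
    have h0 : inner ℝ a (∑ i, α i • v i) = 0 := hle hmem
    simp only [inner_sum, inner_smul_right] at h0
    have hz := (Finset.sum_eq_zero_iff_of_nonneg
      fun i _ => mul_nonneg (hα0 i) (hav i).le).1 h0
    have : ∑ i, α i = 0 := Finset.sum_eq_zero fun i hi =>
      (mul_eq_zero.1 (hz i hi)).resolve_right (hav i).ne'
    rw [this] at hα1
    exact zero_ne_one hα1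
  · intro h
    set S := Submodule.span ℝ (Set.range w) with hS
    -- For `n = 0` the simplex is empty and separation gives no nonzero functional; any nonzero
    -- normal vector to `S` serves, which exists since `m < N`.
    rcases Nat.eq_zero_or_pos n with rfl | hn
    · have hne : S ≠ ⊤ := by
        intro htop
        have h1 := finrank_span_eq_card hw
        rw [← hS, htop, finrank_top, finrank_euclideanSpace_fin, Fintype.card_fin] at h1
        omega
      obtain ⟨a, ha, ha0⟩ := (Submodule.ne_bot_iff _).1
        (mt (Submodule.orthogonal_eq_bot_iff (K := S)).1 hne)
      exact ⟨a, ha0, fun i => Submodule.inner_left_of_mem_orthogonal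
        (Submodule.subset_span (Set.mem_range_self i)) ha, fun j => j.elim0⟩
    · let T := Fintype.linearCombination ℝ v
      have hT : ∀ α, T α = ∑ i, α i • v i := fun α => Fintype.linearCombination_apply ℝ v α
      have hdisj : Disjoint (T '' stdSimplex ℝ (Fin n)) (S : Set (E N)) := by
        rw [Set.disjoint_left]
        rintro _ ⟨α, hα, rfl⟩ hmem
        exact h ⟨α, hα, hT α ▸ hmem⟩
      obtain ⟨f, s, t, hfK, hst, hfS⟩ := geometric_hahn_banach_compact_closed
        ((convex_stdSimplex ℝ (Fin n)).linear_image T)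
        ((isCompact_stdSimplex ℝ (Fin n)).image T.continuous_of_finiteDimensional) S.convex
        S.closed_of_finiteDimensional hdisj
      have ht : t < 0 := by simpa using hfS 0 S.zero_mem
      -- A functional bounded below on a subspace vanishes there: otherwise rescale `x` to reach the
      -- value `t`.
      have hf0 : ∀ x ∈ S, f x = 0 := by
        intro x hx
        by_contra hne
        have := hfS ((t / f x) • x) (S.smul_mem _ hx)
        rw [map_smul, smul_eq_mul, div_mul_cancel₀ _ hne] at this
        exact lt_irrefl _ this
      have hfv : ∀ j, f (v j) < 0 := fun j =>
        (hfK _ ⟨Pi.single j 1, single_mem_stdSimplex ℝ j, by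
          simp [T, Fintype.linearCombination_apply_single]⟩).trans (hst.trans ht)
      let a : E N := -(InnerProductSpace.toDual ℝ (E N)).symm f
      have ha : ∀ x, inner ℝ a x = -f x := fun x => by
        simp [a, inner_neg_left, InnerProductSpace.toDual_symm_apply]
      refine ⟨a, fun h0 => ?_, fun i => ?_, fun j => ?_⟩
      · have := ha (v ⟨0, hn⟩)
        rw [h0, inner_zero_left] at this
        linarith [hfv ⟨0, hn⟩]
      · rw [ha, hf0 _ (Submodule.subset_span (Set.mem_range_self i)), neg_zero]
      · rw [ha]
        linarith [hfv j]

/-! ### Faces of cones over points in general position -/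

/-- The subset `I` of the generators `u` is cut out by a supporting hyperplane. -/
def IsSupported {N r : ℕ} (u : Fin r → E N) (I : Finset (Fin r)) : Prop :=
  ∃ a : E N, a ≠ 0 ∧ (∀ i ∈ I, inner ℝ a (u i) = 0) ∧ ∀ i ∉ I, 0 < inner ℝ a (u i)

/-- Any at most `N` of the vectors `u` in `ℝ^N` are linearly independent. -/
def InGeneralPosition {N r : ℕ} (u : Fin r → E N) : Prop :=
  ∀ J : Finset (Fin r), J.card ≤ N → LinearIndependent ℝ fun i : J => u i

/-- The positive hull of the vectors `u i`, `i ∈ I`. -/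
def subHull {N r : ℕ} (u : Fin r → E N) (I : Finset (Fin r)) : Set (E N) :=
  (PointedCone.hull ℝ (u '' I) : Set (E N))

theorem subset_subHull {N r : ℕ} (u : Fin r → E N) (I : Finset (Fin r)) :
    u '' I ⊆ subHull u I :=
  Submodule.subset_span

theorem finrank_vectorSpan_subHull {N r : ℕ} {u : Fin r → E N} {I : Finset (Fin r)}
    (hI : LinearIndependent ℝ fun i : I => u i) :
    Module.finrank ℝ (vectorSpan ℝ (subHull u I)) = I.card := by
  have h0 : (0 : E N) ∈ subHull u I := Submodule.zero_mem _
  have hspan : vectorSpan ℝ (subHull u I) = Submodule.span ℝ (Set.range fun i : I => u i) := by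
    rw [vectorSpan_eq_span_vsub_set_right ℝ h0]
    simp only [vsub_eq_sub, sub_zero, Set.image_id']
    have hr : Set.range (fun i : I => u i) = u '' I := by
      ext x; simp
    rw [hr]
    apply le_antisymm
    · rw [Submodule.span_le]
      exact Submodule.span_le_restrictScalars {c : ℝ // 0 ≤ c} ℝ (u '' I)
    · exact Submodule.span_mono (subset_subHull u I)
  rw [hspan, finrank_span_eq_card hI, Fintype.card_coe]

theorem inner_nonneg_of_mem_posHull {N r : ℕ} {u : Fin r → E N} {a : E N}
    (ha : ∀ i, 0 ≤ inner ℝ a (u i)) {x : E N} (hx : x ∈ posHull u) : 0 ≤ inner ℝ a x := by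
  obtain ⟨c, hc, rfl⟩ := mem_posHull.1 hx
  simp only [inner_sum, inner_smul_right]
  exact Finset.sum_nonneg fun i _ => mul_nonneg (hc i) (ha i)

/-- A sum of nonnegative terms vanishes only termwise, so generators outside `I` must have
coefficient zero. -/
theorem subHull_eq_sep {N r : ℕ} {u : Fin r → E N} {I : Finset (Fin r)} {a : E N}
    (h0 : ∀ i ∈ I, inner ℝ a (u i) = 0) (hpos : ∀ i ∉ I, 0 < inner ℝ a (u i)) :
    {x ∈ posHull u | inner ℝ a x = 0} = subHull u I := by
  have hnn : ∀ i, 0 ≤ inner ℝ a (u i) := fun i => by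
    by_cases hi : i ∈ I
    · exact (h0 i hi).ge
    · exact (hpos i hi).le
  apply subset_antisymm
  · rintro x ⟨hx, hax⟩
    obtain ⟨c, hc, rfl⟩ := mem_posHull.1 hx
    simp only [inner_sum, inner_smul_right] at hax
    have hz := (Finset.sum_eq_zero_iff_of_nonneg
      fun i _ => mul_nonneg (hc i) (hnn i)).1 hax
    refine Submodule.sum_mem _ fun i hi => ?_
    by_cases hiI : i ∈ I
    · exact Submodule.smul_mem _ (⟨c i, hc i⟩ : {c : ℝ // 0 ≤ c})
        (Submodule.subset_span (Set.mem_image_of_mem u hiI))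
    · rw [(mul_eq_zero.1 (hz i hi)).resolve_right (hpos i hiI).ne', zero_smul]
      exact Submodule.zero_mem _
  · intro x hx
    refine Submodule.span_induction (p := fun x _ => x ∈ posHull u ∧ inner ℝ a x = 0)
      ?_ ?_ ?_ ?_ hx
    · rintro _ ⟨i, hi, rfl⟩
      exact ⟨Submodule.subset_span (Set.mem_range_self i), h0 i hi⟩
    · exact ⟨Submodule.zero_mem _, inner_zero_right a⟩
    · rintro x y - - ⟨hx, hx0⟩ ⟨hy, hy0⟩
      exact ⟨Submodule.add_mem _ hx hy, by rw [inner_add_right, hx0, hy0, add_zero]⟩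
    · rintro c x - ⟨hx, hx0⟩
      refine ⟨Submodule.smul_mem _ c hx, ?_⟩
      change inner ℝ a ((c : ℝ) • x) = 0
      rw [inner_smul_right, hx0, mul_zero]

/-- Otherwise `N` of these vectors would form a basis orthogonal to `a`, forcing `a = 0`. -/
theorem card_lt_of_inner_eq_zero {N r : ℕ} {u : Fin r → E N} (hu : InGeneralPosition u)
    {I : Finset (Fin r)} {a : E N} (ha : a ≠ 0) (h0 : ∀ i ∈ I, inner ℝ a (u i) = 0) :
    I.card < N := by
  by_contra! hcard
  obtain ⟨J, hJI, hJ⟩ := Finset.exists_subset_card_eq hcard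
  have htop : Submodule.span ℝ (Set.range fun i : J => u i) = ⊤ :=
    (hu J hJ.le).span_eq_top_of_card_eq_finrank' (by simp [hJ])
  have hle : Submodule.span ℝ (Set.range fun i : J => u i) ≤ LinearMap.ker (innerₛₗ ℝ a) := by
    rw [Submodule.span_le]
    rintro _ ⟨i, rfl⟩
    exact h0 i (hJI i.2)
  have : a ∈ LinearMap.ker (innerₛₗ ℝ a) := hle (htop ▸ Submodule.mem_top)
  exact ha (inner_self_eq_zero.1 this)

open Classical in
/-- In general position the `m`-dimensional faces of a cone correspond to the `m`-element sets of
generators that are cut out by supporting hyperplanes. -/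
theorem faceCount_posHull {N r m : ℕ} {u : Fin r → E N} (hu : InGeneralPosition u) :
    faceCount m (posHull u) =
      ((Finset.powersetCard m Finset.univ).filter (IsSupported u)).card := by
  have hset : {F : Set (E N) | IsFace (posHull u) F ∧
      Module.finrank ℝ (vectorSpan ℝ F) = m} =
      subHull u '' ((Finset.powersetCard m Finset.univ).filter (IsSupported u) :
        Finset (Finset (Fin r))) := by
    have h0mem : (0 : E N) ∈ posHull u := Submodule.zero_mem _
    ext F
    simp only [Set.mem_ofPred_eq, Set.mem_image, Finset.mem_coe, Finset.mem_filter,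
      Finset.mem_powersetCard_univ]
    constructor
    · rintro ⟨⟨a, c, ha, hc, ⟨y, hy, hyc⟩, rfl⟩, hdim⟩
      -- Supporting hyperplanes of a cone pass through the origin: testing at `0` gives `c ≤ 0`, and
      -- at `2y` gives `c ≤ 2c`.
      have hc0 : c = 0 := by
        have h1 : c ≤ 0 := by simpa using hc 0 h0mem
        have h2 : c ≤ inner ℝ a ((2 : ℝ) • y) := by
          rw [two_smul]
          exact hc _ (Submodule.add_mem _ hy hy)
        rw [inner_smul_right, hyc] at h2
        linarith
      subst hc0
      have hnn : ∀ i, 0 ≤ inner ℝ a (u i) := fun i =>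
        hc _ (Submodule.subset_span (Set.mem_range_self i))
      let I : Finset (Fin r) := Finset.univ.filter fun i => inner ℝ a (u i) = 0
      have hI0 : ∀ i ∈ I, inner ℝ a (u i) = 0 := fun i hi => (Finset.mem_filter.1 hi).2
      have hIpos : ∀ i ∉ I, 0 < inner ℝ a (u i) := fun i hi =>
        lt_of_le_of_ne (hnn i) fun h => hi (Finset.mem_filter.2 ⟨Finset.mem_univ _, h.symm⟩)
      have hcard := card_lt_of_inner_eq_zero hu ha hI0
      rw [subHull_eq_sep hI0 hIpos, finrank_vectorSpan_subHull (hu I hcard.le)] at hdim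
      exact ⟨I, ⟨hdim, a, ha, hI0, hIpos⟩, (subHull_eq_sep hI0 hIpos).symm⟩
    · rintro ⟨I, ⟨hcard, a, ha, hI0, hIpos⟩, rfl⟩
      have hlt := card_lt_of_inner_eq_zero hu ha hI0
      refine ⟨⟨a, 0, ha, fun x hx => inner_nonneg_of_mem_posHull (fun i => ?_) hx,
        ⟨0, h0mem, inner_zero_right a⟩, (subHull_eq_sep hI0 hIpos).symm⟩, ?_⟩
      · by_cases hi : i ∈ I
        · exact (hI0 i hi).ge
        · exact (hIpos i hi).le
      · rw [finrank_vectorSpan_subHull (hu I hlt.le), hcard]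
  -- Distinct supported sets give distinct faces: a generator outside `I` is strictly off the
  -- supporting hyperplane, so it is not in the hull of `I`.
  have hsub : ∀ I I' : Finset (Fin r), IsSupported u I → subHull u I' ⊆ subHull u I →
      I' ⊆ I := by
    rintro I I' ⟨a, -, hI0, hIpos⟩ h i hi
    by_contra hiI
    have := h (subset_subHull u I' (Set.mem_image_of_mem u hi))
    rw [← subHull_eq_sep hI0 hIpos] at this
    exact (hIpos i hiI).ne' this.2
  rw [faceCount, hset, Set.InjOn.ncard_image, Set.ncard_coe_finset]
  intro I hI I' hI' h
  exact subset_antisymm (hsub I' I (Finset.mem_filter.1 hI').2 h.le)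
    (hsub I I' (Finset.mem_filter.1 hI).2 h.ge)

/-! ### Grassmann angles as meeting probabilities -/

theorem continuous_orbitMap {N m : ℕ} (h : m ≤ N) : Continuous (orbitMap h) :=
  continuous_iff_coinduced_le.2
    (le_iSup (fun h : m ≤ N => TopologicalSpace.coinduced (orbitMap h) inferInstance) h)

theorem isClosed_Gr_of_preimage {N m : ℕ} (h : m ≤ N) {s : Set (Gr N m)}
    (hs : IsClosed (orbitMap h ⁻¹' s)) : IsClosed s := by
  rw [← isOpen_compl_iff]
  refine isOpen_iSup_iff.2 fun _ => isOpen_coinduced.2 ?_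
  exact hs.isOpen_compl

theorem mem_meetSet_congr {N n m : ℕ} (v : Fin n → E N) {w w' : Fin m → E N}
    (hw : LinearIndependent ℝ w) (hw' : LinearIndependent ℝ w')
    (h : Submodule.span ℝ (Set.range w) = Submodule.span ℝ (Set.range w')) :
    (v, w) ∈ meetSet N n m ↔ (v, w') ∈ meetSet N n m := by
  rw [mem_meetSet hw, mem_meetSet hw', h]

theorem grassmannHaar_posHull_inter_ne {d n m : ℕ} (h : m ≤ d + 1) {v : Fin n → E (d + 1)}
    (hv : ∀ i, 0 < v i 0) :
    grassmannHaar h {L | posHull v ∩ (L.1 : Set (E (d + 1))) ≠ {0}} =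
      (Measure.pi fun _ : Fin m => uniformHalfSphere d)
        (Prod.mk v ⁻¹' meetSet (d + 1) n m) := by
  have hpre : orbitMap h ⁻¹' {L | posHull v ∩ (L.1 : Set (E (d + 1))) ≠ {0}} =
      {g | rotate g (frame h) ∈ Prod.mk v ⁻¹' meetSet (d + 1) n m} := by
    ext g
    change posHull v ∩ ((orbitMap h g).1 : Set (E (d + 1))) ≠ {0} ↔
      (v, rotate g (frame h)) ∈ meetSet (d + 1) n m
    rw [mem_meetSet (linearIndependent_rotate g (linearIndependent_frame h)),
      posHull_inter_ne_iff hv, span_rotate_frame]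
  have hsec : IsClosed (Prod.mk v ⁻¹' meetSet (d + 1) n m) :=
    (isClosed_meetSet _ _ _).preimage (Continuous.prodMk_right v)
  have hclosed : IsClosed {L : Gr (d + 1) m | posHull v ∩ (L.1 : Set (E (d + 1))) ≠ {0}} := by
    refine isClosed_Gr_of_preimage h ?_
    rw [hpre]
    exact hsec.preimage ((continuous_rotate _ _).comp (Continuous.prodMk_left (frame h)))
  rw [grassmannHaar, Measure.map_apply (continuous_orbitMap h).measurable hclosed.measurableSet,
    hpre]
  exact haarO_rotate_frame_eq h hsec.measurableSet fun w w' hw hw' hs =>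
    mem_meetSet_congr v hw hw' hs

/-- The probability that the positive hull of `n` independent uniform points of the half-sphere
meets the span of `m` further ones nontrivially. -/
def meetProb (d n m : ℕ) : ℝ :=
  ((Measure.pi fun _ : Fin n => uniformHalfSphere d).prod
    (Measure.pi fun _ : Fin m => uniformHalfSphere d)).real (meetSet (d + 1) n m)

theorem ae_pos {Ω : Type*} [MeasurableSpace Ω] {μ : Measure Ω} {d : ℕ}
    {U : ℕ → Ω → E (d + 1)} (hlaw : ∀ i, HasLaw (U i) (uniformHalfSphere d) μ) :
    ∀ᵐ ω ∂μ, ∀ i, 0 < U i ω 0 :=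
  ae_all_iff.2 fun i => ((hlaw i).ae_iff
    (measurableSet_lt measurable_const measurable_coord).mem).2 (ae_pos_uniformHalfSphere d)

theorem grassmannAngle_cone_ae_eq {Ω : Type*} [MeasurableSpace Ω] {μ : Measure Ω} {d : ℕ}
    {U : ℕ → Ω → E (d + 1)} (hlaw : ∀ i, HasLaw (U i) (uniformHalfSphere d) μ)
    (n k : ℕ) :
    (fun ω => grassmannAngle (k + 1) (cone U n ω)) =ᵐ[μ] fun ω =>
      1 / 2 * (Measure.pi fun _ : Fin (d + 1 - k) => uniformHalfSphere d).real
        (Prod.mk (fun i : Fin n => U i ω) ⁻¹' meetSet (d + 1) n (d + 1 - k)) := by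
  filter_upwards [ae_pos hlaw] with ω hω
  exact congrArg (fun x : ℝ≥0∞ => 1 / 2 * x.toReal)
    (grassmannHaar_posHull_inter_ne (Nat.sub_le (d + 1) k)
      (v := fun i : Fin n => U i ω) fun i => hω i)

/-! ### Expectations -/

/-- The index map that lists the complement of an `m`-element set, and then the set itself. -/
def listing {r n m : ℕ} (I : Finset (Fin r)) (hI : I.card = m) (hIc : Iᶜ.card = n) :
    Fin n ⊕ Fin m → ℕ :=
  fun x => (Sum.elim (Iᶜ.orderEmbOfFin hIc) (I.orderEmbOfFin hI) x : Fin r)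

theorem listing_injective {r n m : ℕ} (I : Finset (Fin r)) (hI : I.card = m)
    (hIc : Iᶜ.card = n) : Function.Injective (listing I hI hIc) := by
  refine Fin.val_injective.comp (Function.Injective.sumElim (Iᶜ.orderEmbOfFin hIc).injective
    (I.orderEmbOfFin hI).injective fun i j h => ?_)
  have h1 := Finset.orderEmbOfFin_mem Iᶜ hIc i
  rw [h, Finset.mem_compl] at h1
  exact h1 (Finset.orderEmbOfFin_mem I hI j)

theorem isSupported_iff_notMem_meetSet {N r n m : ℕ} (hm : m < N) {u : ℕ → E N}
    (hu : InGeneralPosition fun i : Fin r => u i) {I : Finset (Fin r)} (hI : I.card = m)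
    (hIc : Iᶜ.card = n) :
    IsSupported (fun i : Fin r => u i) I ↔
      ((fun i => u (listing I hI hIc (.inl i))), fun j => u (listing I hI hIc (.inr j))) ∉
        meetSet N n m := by
  have hw : LinearIndependent ℝ fun j => u (listing I hI hIc (.inr j)) :=
    (hu I (hI.trans_le hm.le)).comp _ (I.orderIsoOfFin hI).injective
  rw [← exists_inner_pos_iff_notMem_meetSet hm hw]
  refine exists_congr fun a => and_congr_right fun _ => and_congr ?_ ?_
  · constructor
    · exact fun h i => h _ (Finset.orderEmbOfFin_mem I hI i)
    · intro h i hi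
      rw [← Finset.mem_coe, ← Finset.range_orderEmbOfFin I hI] at hi
      obtain ⟨j, rfl⟩ := hi
      exact h j
  · constructor
    · exact fun h i => h _ (Finset.mem_compl.1 (Finset.orderEmbOfFin_mem Iᶜ hIc i))
    · intro h i hi
      rw [← Finset.mem_compl, ← Finset.mem_coe, ← Finset.range_orderEmbOfFin Iᶜ hIc] at hi
      obtain ⟨j, rfl⟩ := hi
      exact h j

section Independent

variable {Ω : Type*} [MeasurableSpace Ω] {μ : Measure Ω} {d : ℕ} {U : ℕ → Ω → E (d + 1)}

theorem hasLaw_pi {ι : Type*} [Fintype ι] (hlaw : ∀ i, HasLaw (U i) (uniformHalfSphere d) μ)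
    (hindep : iIndepFun U μ) {f : ι → ℕ} (hf : Function.Injective f) :
    HasLaw (fun ω i => U (f i) ω) (Measure.pi fun _ : ι => uniformHalfSphere d) μ :=
  (hindep.precomp hf).hasLaw_pi fun i => hlaw (f i)

theorem hasLaw_prod_pi (hlaw : ∀ i, HasLaw (U i) (uniformHalfSphere d) μ)
    (hindep : iIndepFun U μ) {n m : ℕ} {f : Fin n ⊕ Fin m → ℕ} (hf : Function.Injective f) :
    HasLaw (fun ω => ((fun i => U (f (.inl i)) ω), fun j => U (f (.inr j)) ω))
      ((Measure.pi fun _ : Fin n => uniformHalfSphere d).prod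
        (Measure.pi fun _ : Fin m => uniformHalfSphere d)) μ :=
  (measurePreserving_sumPiEquivProdPi
    fun _ : Fin n ⊕ Fin m => uniformHalfSphere d).hasLaw.fun_comp (hasLaw_pi hlaw hindep hf)

theorem ae_inGeneralPosition (hlaw : ∀ i, HasLaw (U i) (uniformHalfSphere d) μ)
    (hindep : iIndepFun U μ) (r : ℕ) :
    ∀ᵐ ω ∂μ, InGeneralPosition fun i : Fin r => U i ω := by
  refine ae_all_iff.2 fun J => ?_
  by_cases hJ : J.card ≤ d + 1
  · have hX := hasLaw_pi hlaw hindep (f := fun i => (J.orderEmbOfFin rfl i : ℕ))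
      (Fin.val_injective.comp (J.orderEmbOfFin rfl).injective)
    have hmeas : MeasurableSet {w : Fin J.card → E (d + 1) | LinearIndependent ℝ w} :=
      isOpen_setOfPred_linearIndependent.measurableSet
    filter_upwards [(hX.ae_iff hmeas.mem).2
      (ae_linearIndependent_pi _ uniformHalfSphere_submodule hJ)] with ω hω _
    exact (linearIndependent_equiv (J.orderIsoOfFin rfl).toEquiv).1 hω
  · exact .of_forall fun ω h => absurd h hJ

variable [IsProbabilityMeasure μ]

theorem integral_grassmannAngle_cone (hlaw : ∀ i, HasLaw (U i) (uniformHalfSphere d) μ)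
    (hindep : iIndepFun U μ) (n k : ℕ) :
    Integrable (fun ω => grassmannAngle (k + 1) (cone U n ω)) μ ∧
      ∫ ω, grassmannAngle (k + 1) (cone U n ω) ∂μ = 1 / 2 * meetProb d n (d + 1 - k) := by
  set m := d + 1 - k with hm
  let q : (Fin n → E (d + 1)) → ℝ := fun v =>
    (Measure.pi fun _ : Fin m => uniformHalfSphere d).real (Prod.mk v ⁻¹' meetSet (d + 1) n m)
  have hmeas : MeasurableSet (meetSet (d + 1) n m) := (isClosed_meetSet _ _ _).measurableSet
  have hq : Measurable q := (measurable_measure_prodMk_left hmeas).ennreal_toReal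
  have hX := hasLaw_pi hlaw hindep (f := fun i : Fin n => (i : ℕ)) Fin.val_injective
  have hae := grassmannAngle_cone_ae_eq hlaw n k
  have hint : Integrable (fun ω => 1 / 2 * q fun i : Fin n => U i ω) μ := by
    refine Integrable.const_mul (Integrable.of_bound
      (hq.comp_aemeasurable hX.aemeasurable).aestronglyMeasurable 1 (.of_forall fun ω => ?_)) _
    refine (Real.norm_of_nonneg measureReal_nonneg).trans_le ?_
    exact measureReal_le_one
  refine ⟨hint.congr hae.symm, ?_⟩
  rw [integral_congr_ae hae, integral_const_mul]
  congr 1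
  refine (hX.integral_comp hq.aestronglyMeasurable).trans ?_
  rw [meetProb, measureReal_def, Measure.prod_apply hmeas]
  exact integral_toReal (measurable_measure_prodMk_left hmeas).aemeasurable
    (.of_forall fun v => measure_lt_top _ _)

/-- Linearity of expectation over the `m`-element index sets. The indicators are dependent, but each
has the same mean, since listing the indices as complement and set always gives the same joint law.
-/
theorem integral_faceCount_cone (hlaw : ∀ i, HasLaw (U i) (uniformHalfSphere d) μ)
    (hindep : iIndepFun U μ) {n m : ℕ} (hm : m ≤ d) :
    Integrable (fun ω => (faceCount m (cone U (n + m) ω) : ℝ)) μ ∧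
      ∫ ω, (faceCount m (cone U (n + m) ω) : ℝ) ∂μ =
        ((n + m).choose m : ℝ) * (1 - meetProb d n m) := by
  classical
  have hmeas : MeasurableSet (meetSet (d + 1) n m) := (isClosed_meetSet _ _ _).measurableSet
  let P : Finset (Finset (Fin (n + m))) := Finset.powersetCard m Finset.univ
  have hcard : ∀ I : P, I.1.card = m := fun I => Finset.mem_powersetCard_univ.1 I.2
  have hcardc : ∀ I : P, (I.1)ᶜ.card = n := fun I => by
    rw [Finset.card_compl, hcard I, Fintype.card_fin, Nat.add_sub_cancel]
  let X : P → Ω → (Fin n → E (d + 1)) × (Fin m → E (d + 1)) := fun I ω =>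
    ((fun i => U (listing I.1 (hcard I) (hcardc I) (.inl i)) ω),
      fun j => U (listing I.1 (hcard I) (hcardc I) (.inr j)) ω)
  have hX : ∀ I : P, HasLaw (X I) ((Measure.pi fun _ : Fin n => uniformHalfSphere d).prod
      (Measure.pi fun _ : Fin m => uniformHalfSphere d)) μ := fun I =>
    hasLaw_prod_pi hlaw hindep (listing_injective I.1 (hcard I) (hcardc I))
  let g : (Fin n → E (d + 1)) × (Fin m → E (d + 1)) → ℝ :=
    (meetSet (d + 1) n m)ᶜ.indicator 1
  have hg : Measurable g := measurable_one.indicator hmeas.compl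
  have hgint : ∀ I : P, Integrable (fun ω => g (X I ω)) μ := fun I => by
    refine Integrable.of_bound (hg.comp_aemeasurable (hX I).aemeasurable).aestronglyMeasurable 1
      (.of_forall fun ω => ?_)
    exact (norm_indicator_le_norm_self _ _).trans (by simp)
  have hgval : ∀ I : P, ∫ ω, g (X I ω) ∂μ = 1 - meetProb d n m := fun I => by
    refine ((hX I).integral_comp hg.aestronglyMeasurable).trans ?_
    rw [integral_indicator_one hmeas.compl, probReal_compl_eq_one_sub hmeas, meetProb]
  have hae : (fun ω => (faceCount m (cone U (n + m) ω) : ℝ)) =ᵐ[μ]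
      fun ω => ∑ I : P, g (X I ω) := by
    filter_upwards [ae_inGeneralPosition hlaw hindep (n + m)] with ω hω
    rw [cone, faceCount_posHull hω, Finset.card_filter, Nat.cast_sum, ← Finset.sum_coe_sort]
    refine Finset.sum_congr rfl fun I _ => ?_
    have := isSupported_iff_notMem_meetSet (u := fun i => U i ω) (Nat.lt_succ_of_le hm) hω
      (hcard I) (hcardc I)
    rw [Nat.cast_ite, Nat.cast_one, Nat.cast_zero]
    change _ = (meetSet (d + 1) n m)ᶜ.indicator 1 (X I ω)
    rw [Set.indicator_apply]
    exact if_congr this rfl rfl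
  refine ⟨(integrable_finsetSum _ fun I _ => hgint I).congr hae.symm, ?_⟩
  rw [integral_congr_ae hae, integral_finsetSum _ fun I _ => hgint I,
    Finset.sum_congr rfl fun I _ => hgval I, Finset.sum_const, nsmul_eq_mul]
  simp [P]

end Independent

end RandomCones

end

theorem theorem5 {Ω : Type*} [MeasurableSpace Ω] (μ : MeasureTheory.Measure Ω)
    [MeasureTheory.IsProbabilityMeasure μ] (d : ℕ) (U : ℕ → Ω → RandomCones.E (d + 1))
    (hlaw : ∀ i, ProbabilityTheory.HasLaw (U i) (RandomCones.uniformHalfSphere d) μ)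
    (hindep : ProbabilityTheory.iIndepFun U μ)
    (n k : ℕ) (hk1 : 1 ≤ k) (hkd : k ≤ d) :
    MeasureTheory.Integrable (fun ω => RandomCones.grassmannAngle (k + 1) (RandomCones.cone U n ω)) μ ∧
    MeasureTheory.Integrable
      (fun ω => (RandomCones.faceCount (d + 1 - k) (RandomCones.cone U (n + d + 1 - k) ω) : ℝ)) μ ∧
    2 * ((n + d + 1 - k).choose (d + 1 - k) : ℝ) *
        (1 / 2 - ∫ ω, RandomCones.grassmannAngle (k + 1) (RandomCones.cone U n ω) ∂μ) =
      ∫ ω, (RandomCones.faceCount (d + 1 - k) (RandomCones.cone U (n + d + 1 - k) ω) : ℝ) ∂μ := by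
  obtain ⟨hint, hval⟩ := RandomCones.integral_grassmannAngle_cone hlaw hindep n k
  have hr : n + d + 1 - k = n + (d + 1 - k) := by omega
  -- Here `1 ≤ k` enters: it gives `m ≤ d`, so `m` generators always fit in a hyperplane.
  obtain ⟨hint', hval'⟩ := RandomCones.integral_faceCount_cone hlaw hindep (n := n)
    (m := d + 1 - k) (by omega)
  rw [hr]
  refine ⟨hint, hint', ?_⟩
  rw [hval, hval']
  ring
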